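/- All graphs are finite and simple. A graph is \emph{locally irregular} if any two adjacent vertices have distinct degrees. A \emph{locally irregular decomposition} of a graph $G$ of size $k$ is a collection of $k$ locally irregular subgraphs $H_1,\dots,H_k$ of $G$ such that $\{E(H_1),\dots,E(H_k)\}$ is a partition of $E(G)$ into nonempty parts; $\chi'_{\rm irr}(G)$ denotes the smallest size of a locally irregular decomposition of $G$, with $\chi'_{\rm irr}(G)=\infty$ if there is none. \textbf{Theorem.} Let $G$ be a graph whose vertex set is the disjoint union of an inclusion-maximal clique $X=\{v_1,\dots,v_n\}$ with $n$ vertices and a stable set $Y$. Let $d_i$ be the number of neighbours of $v_i$ in $Y$, where the vertices are labelled so that $d_1\ge\cdots\ge d_n$. If $n\ge 10$, then the following hold. \begin{enumerate} \item[(i)] $\chi'_{\rm irr}(G)\le 2$ if and only if $d_1\ge\lfloor n/2\rfloor$ or $d_2\ge 1$. \item[(ii)] $\chi'_{\rm irr}(G)=3$ if and only if $d_1<\lfloor n/2\rfloor$ and $d_2=0$. \end{enumerate} In particular, $\chi'_{\rm irr}(G)\le 3$, that is, $G$ decomposes into at most three locally irregular subgraphs. -/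

import Mathlib

namespace SplitIrr

/-- A graph is locally irregular if adjacent vertices have distinct degrees. -/
def IsLocallyIrregular {V : Type*} (G : SimpleGraph V) [G.LocallyFinite] : Prop :=
  ∀ ⦃u v : V⦄, G.Adj u v → G.degree u ≠ G.degree v

/-- The subgraphs `H 0, …, H (k - 1)` form a decomposition of `G`: their edge sets are the
(nonempty, pairwise disjoint) parts of a partition of the edge set of `G`. -/
structure IsDecomposition {V : Type*} (G : SimpleGraph V) {k : ℕ} (H : Fin k → G.Subgraph) :
    Prop where
  nonempty : ∀ i, (H i).edgeSet.Nonempty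
  disjoint : ∀ i j, i ≠ j → Disjoint (H i).edgeSet (H j).edgeSet
  cover : ⋃ i, (H i).edgeSet = G.edgeSet

open Classical in
/-- `G` has a decomposition into exactly `k` subgraphs, each of which is locally irregular
(as a graph in its own right). -/
def HasIrrDecomposition {V : Type*} [Fintype V] (G : SimpleGraph V) (k : ℕ) : Prop :=
  ∃ H : Fin k → G.Subgraph, IsDecomposition G H ∧ ∀ i, IsLocallyIrregular (H i).coe

/-- The irregular chromatic index: the smallest size of a locally irregular decomposition of `G`,
with value `⊤` if and only if `G` is not decomposable. -/
noncomputable def irrChromaticIndex {V : Type*} [Fintype V] (G : SimpleGraph V) : ℕ∞ :=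
  ⨅ (k : ℕ) (_ : HasIrrDecomposition G k), (k : ℕ∞)

/-- `G` is a split graph `G(X, Y)`: `X` is a maximal clique and its complement `Y` is stable. -/
structure IsSplit {V : Type*} (G : SimpleGraph V) (X Y : Set V) : Prop where
  maximal_clique : Maximal G.IsClique X
  compl : Y = Xᶜ
  stable : G.IsIndepSet Y

/-- The number of neighbours of `v` in `Y`. -/
noncomputable def degIn {V : Type*} (G : SimpleGraph V) (v : V) (Y : Set V) : ℕ :=
  (G.neighborSet v ∩ Y).ncard

end SplitIrr

/-
Label the clique by `Fin n`. The graph joining `i` and `j` when `i + j ≥ 2 ⌊n / 2⌋` and its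
complement colour the clique so that each colour has a single coincidence of degrees, and the
clique labels can be ordered so that the edges leaving the clique resolve it without creating new
conflicts. Where they cannot, the degrees at the last vertex are corrected by switching the colours
along one or two alternating cycles through it.

Conversely, suppose only `v₁` has neighbours outside the clique. In a decomposition into two parts,
the other `n - 1` clique vertices must have distinct degrees in each part. Their degrees within the
clique are then `1, …, n - 1` in one of the parts, which is equality in the Erdős–Gallai inequality
and so determines the neighbourhood of `v₁` there: it consists of the `⌊n / 2⌋` vertices of largest
degree. To differ from all of their degrees, and from those of the remaining vertices in the other
part, `v₁` needs `⌊n / 2⌋` neighbours outside the clique. For three parts, a star at `v₁` is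
removed first: `v₁` then joins the stable set, and all but two vertices of the remaining clique have
a neighbour in it.
-/

namespace SplitIrr

open Function Set

section Colourings

variable {V : Type*} {G : SimpleGraph V} {k l : ℕ}

theorem isLocallyIrregular_coe_iff [Finite V] (H : G.Subgraph) [H.coe.LocallyFinite]
    [H.spanningCoe.LocallyFinite] :
    IsLocallyIrregular H.coe ↔ IsLocallyIrregular H.spanningCoe := by
  have hdeg (v : H.verts) : H.coe.degree v = H.spanningCoe.degree v := by
    have := Fintype.ofFinite (H.neighborSet v)
    rw [H.coe_degree, H.degree_spanningCoe]
  exact ⟨fun h u v huv => hdeg ⟨u, H.edge_vert huv⟩ ▸ hdeg ⟨v, H.edge_vert huv.symm⟩ ▸ h huv,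
    fun h u v huv => hdeg u ▸ hdeg v ▸ h huv⟩

theorem isLocallyIrregular_bot [(⊥ : SimpleGraph V).LocallyFinite] :
    IsLocallyIrregular (⊥ : SimpleGraph V) :=
  fun _ _ h => h.elim

variable [Fintype V]

open Classical in
/-- `G` is the edge-disjoint union of `k` locally irregular graphs. In contrast with
`HasIrrDecomposition`, a part may be empty, so that this notion is monotone in `k`. -/
def IrrColorable (G : SimpleGraph V) (k : ℕ) : Prop :=
  ∃ C : Fin k → SimpleGraph V,
    Pairwise (Disjoint on C) ∧ ⨆ i, C i = G ∧ ∀ i, IsLocallyIrregular (C i)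

open Classical in
theorem irrColorable_succ_iff :
    IrrColorable G (k + 1) ↔ ∃ F ≤ G, IsLocallyIrregular F ∧ IrrColorable (G \ F) k := by
  have iSup_eq (C : Fin (k + 1) → SimpleGraph V) : ⨆ i, C i = C 0 ⊔ ⨆ i : Fin k, C i.succ := by
    ext
    simp [Fin.exists_fin_succ]
  constructor
  · rintro ⟨C, hdisj, rfl, hC⟩
    have hrest : (⨆ i, C i) \ C 0 = ⨆ i : Fin k, C i.succ := by
      refine Disjoint.sdiff_eq_of_sup_eq ?_ (iSup_eq C).symm
      exact disjoint_iSup_iff.2 fun i => hdisj i.succ_ne_zero.symm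
    exact ⟨C 0, le_iSup C 0, hC 0, fun i => C i.succ,
      fun i j hij => hdisj (Fin.succ_injective k |>.ne hij), hrest.symm, fun i => hC i.succ⟩
  · rintro ⟨F, hFG, hF, C, hdisj, hsup, hC⟩
    have hFC (i : Fin k) : Disjoint F (C i) :=
      disjoint_sdiff_self_right.mono_right (hsup ▸ le_iSup C i)
    refine ⟨Fin.cons F C, fun i j hij => ?_, ?_, Fin.cases hF hC⟩
    · cases i using Fin.cases with
      | zero => cases j using Fin.cases with
        | zero => exact absurd rfl hij
        | succ j => exact hFC j
      | succ i => cases j using Fin.cases with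
        | zero => exact (hFC i).symm
        | succ j => exact hdisj (ne_of_apply_ne Fin.succ hij)
    · rw [iSup_eq, ← sup_sdiff_cancel_right hFG, ← hsup]
      rfl

theorem irrColorable_one_iff [G.LocallyFinite] : IrrColorable G 1 ↔ IsLocallyIrregular G := by
  constructor
  · rintro ⟨C, -, rfl, hC⟩
    convert hC 0
    exact iSup_unique (f := C)
  · exact fun hG => ⟨fun _ => G, Subsingleton.pairwise, iSup_const, fun _ => by convert hG⟩

open Classical in
theorem irrColorable_two_iff :
    IrrColorable G 2 ↔ ∃ R ≤ G, IsLocallyIrregular R ∧ IsLocallyIrregular (G \ R) := by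
  rw [irrColorable_succ_iff]
  refine exists_congr fun R => and_congr_right fun _ => and_congr_right fun _ => ?_
  rw [irrColorable_one_iff]

theorem IrrColorable.mono (hkl : k ≤ l) (hG : IrrColorable G k) : IrrColorable G l := by
  induction hkl with
  | refl => exact hG
  | step _ ih =>
    exact irrColorable_succ_iff.2 ⟨⊥, bot_le, by convert isLocallyIrregular_bot, by rwa [sdiff_bot]⟩

theorem HasIrrDecomposition.irrColorable (hG : HasIrrDecomposition G k) : IrrColorable G k := by
  classical
  obtain ⟨H, hH, hirr⟩ := hG
  refine ⟨fun i => (H i).spanningCoe, fun i j hij => ?_, ?_,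
    fun i => (isLocallyIrregular_coe_iff _).1 (hirr i)⟩
  · exact SimpleGraph.disjoint_edgeSet.1 (hH.disjoint i j hij)
  · rw [← SimpleGraph.edgeSet_inj, SimpleGraph.edgeSet_iSup]
    exact hH.cover

theorem IrrColorable.exists_hasIrrDecomposition (hG : IrrColorable G k) :
    ∃ l ≤ k, HasIrrDecomposition G l := by
  classical
  obtain ⟨C, hdisj, hsup, hC⟩ := hG
  have hle (i : Fin k) : C i ≤ G := hsup ▸ le_iSup C i
  have hedge (i : Fin k) : (SimpleGraph.toSubgraph (C i) (hle i)).edgeSet = (C i).edgeSet :=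
    Set.ext (Sym2.ind fun _ _ => Iff.rfl)
  let e := (Fintype.equivFin {i // C i ≠ ⊥}).symm
  have hcard : Fintype.card {i // C i ≠ ⊥} ≤ k :=
    (Fintype.card_subtype_le _).trans_eq (Fintype.card_fin k)
  refine ⟨_, hcard, fun j => SimpleGraph.toSubgraph (C (e j)) (hle _),
    ⟨fun j => ?_, fun i j hij => ?_, ?_⟩, fun j => (isLocallyIrregular_coe_iff _).2 (hC _)⟩
  · rw [hedge, SimpleGraph.edgeSet_nonempty]
    exact (e j).2
  · rw [hedge, hedge, SimpleGraph.disjoint_edgeSet]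
    exact hdisj fun h => hij (e.injective (Subtype.ext h))
  · simp only [hedge]
    rw [e.surjective.iUnion_comp fun i => (C i).edgeSet, ← hsup, SimpleGraph.edgeSet_iSup]
    refine Subset.antisymm (iUnion_subset fun i => subset_iUnion (fun i => (C i).edgeSet) _) ?_
    refine iUnion_subset fun i => ?_
    by_cases hi : C i = ⊥
    · simp [hi]
    · exact subset_iUnion (fun i : {i // C i ≠ ⊥} => (C i).edgeSet) ⟨i, hi⟩

theorem irrChromaticIndex_le_iff : irrChromaticIndex G ≤ k ↔ IrrColorable G k := by
  constructor
  · intro h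
    obtain ⟨l, hl⟩ := iInf_lt_iff.1 ((ENat.lt_natCast_add_one_iff).2 h)
    obtain ⟨hdec, hl⟩ := iInf_lt_iff.1 hl
    exact hdec.irrColorable.mono (Nat.lt_add_one_iff.1 (by exact_mod_cast hl))
  · intro hG
    obtain ⟨l, hl, hdec⟩ := hG.exists_hasIrrDecomposition
    exact (iInf₂_le l hdec).trans (by exact_mod_cast hl)

theorem irrChromaticIndex_eq_succ_iff :
    irrChromaticIndex G = k + 1 ↔ IrrColorable G (k + 1) ∧ ¬ IrrColorable G k := by
  rw [← irrChromaticIndex_le_iff, ← irrChromaticIndex_le_iff, not_le, ← ENat.add_one_le_iff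
    (ENat.natCast_ne_top k), Nat.cast_add_one]
  exact le_antisymm_iff

end Colourings

section SplitLabellings

variable {V ι : Type*} {G : SimpleGraph V} {w : ι → V} {i : ι} {y : V}

/-- The injective family `w` labels a clique of `G` whose complement is stable: a split graph
together with a labelling of its clique. The clique need not be maximal. -/
structure IsSplitLabelling (G : SimpleGraph V) (w : ι → V) : Prop where
  injective : Injective w
  adj : Pairwise (G.Adj on w)
  isIndepSet : G.IsIndepSet (range w)ᶜ

/-- The number of neighbours of `w i` outside the vertices labelled by `w`: the `dᵢ` of the
theorem, for an arbitrary labelling. -/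
noncomputable def leafDeg (G : SimpleGraph V) (w : ι → V) (i : ι) : ℕ :=
  degIn G (w i) (range w)ᶜ

theorem IsSplitLabelling.comp [Finite ι] (hw : IsSplitLabelling G w) {p : ι → ι}
    (hp : Injective p) : IsSplitLabelling G (w ∘ p) where
  injective := hw.injective.comp hp
  adj _ _ hij := hw.adj (hp.ne hij)
  isIndepSet := by
    rw [(Finite.surjective_of_injective hp).range_comp]
    exact hw.isIndepSet

theorem leafDeg_comp [Finite ι] {p : ι → ι} (hp : Injective p) (i : ι) :
    leafDeg G (w ∘ p) i = leafDeg G w (p i) := by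
  rw [leafDeg, (Finite.surjective_of_injective hp).range_comp]
  rfl

theorem antitoneOn_leafDeg_comp [Finite ι] [Preorder ι] (hanti : Antitone (leafDeg G w))
    {p : ι → ι} (hp : Injective p) {s : Set ι} (hs : MonotoneOn p s) :
    AntitoneOn (leafDeg G (w ∘ p)) s := by
  intro i hi j hj hij
  simpa only [leafDeg_comp hp] using hanti (hs hi hj hij)

theorem IsSplit.isSplitLabelling {X Y : Set V} (hG : IsSplit G X Y) (hw : Injective w)
    (hX : range w = X) : IsSplitLabelling G w := by
  obtain ⟨hmax, rfl, hstable⟩ := hG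
  subst hX
  exact ⟨hw, fun i j hij => hmax.prop ⟨i, rfl⟩ ⟨j, rfl⟩ (hw.ne hij), hstable⟩

theorem IsSplit.exists_not_adj {X Y : Set V} (hG : IsSplit G X Y) (hy : y ∉ X) :
    ∃ x ∈ X, ¬ G.Adj x y := by
  by_contra! h
  have hclique : G.IsClique (insert y X) :=
    hG.maximal_clique.prop.insert fun x hx _ => (h x hx).symm
  exact hy (hG.maximal_clique.le_of_ge hclique (subset_insert y X) (mem_insert y X))

theorem degree_eq_ncard (H : SimpleGraph V) (v : V) [Fintype (H.neighborSet v)] :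
    H.degree v = (H.neighborSet v).ncard := by
  rw [← H.card_neighborSet_eq_degree, ← Nat.card_coe_set_eq, Nat.card_eq_fintype_card]

variable [Finite V]

theorem degree_apply_eq (hw : Injective w) (H : SimpleGraph V) (i : ι)
    [Fintype (H.neighborSet (w i))] [Fintype ((H.comap w).neighborSet i)] :
    H.degree (w i) = (H.comap w).degree i + leafDeg H w i := by
  have hcomap : ((H.comap w).neighborSet i).ncard = (H.neighborSet (w i) ∩ range w).ncard := by
    rw [← image_preimage_eq_inter_range, ncard_image_of_injective _ hw]
    rfl
  rw [degree_eq_ncard, degree_eq_ncard, hcomap, leafDeg, degIn, ← sdiff_eq,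
    ncard_inter_add_ncard_sdiff_eq_ncard _ _ (toFinite _)]

theorem leafDeg_pos_of_adj (hy : y ∉ range w) (h : G.Adj (w i) y) : 0 < leafDeg G w i :=
  (ncard_pos (toFinite _)).2 ⟨y, h, hy⟩

theorem eq_of_adj_of_leafDeg_eq_one {y' : V} (hi : leafDeg G w i = 1) (hy : y ∉ range w)
    (h : G.Adj (w i) y) (hy' : y' ∉ range w) (h' : G.Adj (w i) y') : y = y' :=
  (ncard_le_one (toFinite _)).1 hi.le y ⟨h, hy⟩ y' ⟨h', hy'⟩

end SplitLabellings

section ColourClasses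

variable {V ι : Type*} {G : SimpleGraph V} {w : ι → V} {C : SimpleGraph ι} {L : Set ι}
  {i j : ι} {x y : V}

/-- The spanning subgraph of a split graph in which the labels of the clique are joined as in `C`,
while the edges leaving the clique at `w i` are present if and only if `i ∈ L`. In each of our
decompositions, all edges from a clique vertex to the stable set receive the same colour. -/
def colourClass (G : SimpleGraph V) (w : ι → V) (C : SimpleGraph ι) (L : Set ι) : SimpleGraph V :=
  C.map w ⊔ G.between (w '' L) (range w)ᶜ

theorem colourClass_adj_apply (hw : Injective w) :
    (colourClass G w C L).Adj (w i) (w j) ↔ C.Adj i j := by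
  simp only [colourClass, SimpleGraph.sup_adj, SimpleGraph.between_adj, SimpleGraph.map_adj',
    mem_compl_iff, mem_range_self, not_true, and_false, false_and, or_self, or_false, hw.eq_iff,
    hw.ne_iff]
  grind [C.ne_of_adj]

theorem comap_colourClass (hw : Injective w) : (colourClass G w C L).comap w = C :=
  SimpleGraph.ext (funext₂ fun _ _ => propext (colourClass_adj_apply hw))

theorem colourClass_adj_of_notMem (hw : Injective w) (hy : y ∉ range w) :
    (colourClass G w C L).Adj (w i) y ↔ i ∈ L ∧ G.Adj (w i) y := by
  have : ∀ k, w k ≠ y := fun k hk => hy ⟨k, hk⟩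
  simp [colourClass, SimpleGraph.between_adj, SimpleGraph.map_adj', hw.mem_set_image, this,
    and_comm]

theorem not_colourClass_adj (hx : x ∉ range w) (hy : y ∉ range w) :
    ¬ (colourClass G w C L).Adj x y := by
  have hx' : ∀ k, w k ≠ x := fun k hk => hx ⟨k, hk⟩
  have hy' : ∀ k, w k ≠ y := fun k hk => hy ⟨k, hk⟩
  simp [colourClass, SimpleGraph.between_adj, SimpleGraph.map_adj', hx', hy']

theorem colourClass_le (hw : IsSplitLabelling G w) : colourClass G w C L ≤ G := by
  refine sup_le ?_ fun _ _ h => h.1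
  rintro _ _ ⟨-, i, j, hij, rfl, rfl⟩
  exact hw.adj hij.ne

theorem sdiff_colourClass (hw : IsSplitLabelling G w) :
    G \ colourClass G w C L = colourClass G w Cᶜ Lᶜ := by
  have hleaf (i : ι) {y : V} (hy : y ∉ range w) :
      (G \ colourClass G w C L).Adj (w i) y ↔ (colourClass G w Cᶜ Lᶜ).Adj (w i) y := by
    rw [SimpleGraph.sdiff_adj, colourClass_adj_of_notMem hw.injective hy,
      colourClass_adj_of_notMem hw.injective hy, mem_compl_iff]
    tauto
  ext x y
  by_cases hx : x ∈ range w <;> by_cases hy : y ∈ range w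
  · obtain ⟨i, rfl⟩ := hx
    obtain ⟨j, rfl⟩ := hy
    have hG : G.Adj (w i) (w j) ↔ i ≠ j := ⟨fun h hij => h.ne (hij ▸ rfl), fun h => hw.adj h⟩
    rw [SimpleGraph.sdiff_adj, colourClass_adj_apply hw.injective,
      colourClass_adj_apply hw.injective, hG, SimpleGraph.compl_adj]
  · obtain ⟨i, rfl⟩ := hx
    exact hleaf i hy
  · obtain ⟨j, rfl⟩ := hy
    rw [SimpleGraph.adj_comm, hleaf j hx, SimpleGraph.adj_comm]
  · refine iff_of_false (fun h => ?_) (not_colourClass_adj hx hy)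
    exact hw.isIndepSet hx hy h.1.ne h.1

theorem degree_colourClass_of_notMem (hw : Injective w) (hy : y ∉ range w)
    [Fintype ((colourClass G w C L).neighborSet y)] :
    (colourClass G w C L).degree y = {i ∈ L | G.Adj (w i) y}.ncard := by
  have hset : (colourClass G w C L).neighborSet y = w '' {i ∈ L | G.Adj (w i) y} := by
    ext x
    rw [SimpleGraph.mem_neighborSet]
    by_cases hx : x ∈ range w
    · obtain ⟨i, rfl⟩ := hx
      rw [SimpleGraph.adj_comm, colourClass_adj_of_notMem hw hy, hw.mem_set_image, mem_ofPred]
    · exact iff_of_false (not_colourClass_adj hy hx) fun h => hx (image_subset_range w _ h)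
  rw [degree_eq_ncard, hset, ncard_image_of_injective _ hw]

variable [Finite V]

theorem degree_colourClass_apply (hw : Injective w) (C : SimpleGraph ι) (L : Set ι) (i : ι)
    [Decidable (i ∈ L)] [Fintype ((colourClass G w C L).neighborSet (w i))]
    [Fintype (C.neighborSet i)] :
    (colourClass G w C L).degree (w i) = C.degree i + if i ∈ L then leafDeg G w i else 0 := by
  have hleaf : leafDeg (colourClass G w C L) w i = if i ∈ L then leafDeg G w i else 0 := by
    have hset : (colourClass G w C L).neighborSet (w i) ∩ (range w)ᶜ =
        {_y | i ∈ L} ∩ (G.neighborSet (w i) ∩ (range w)ᶜ) := by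
      ext y
      by_cases hy : y ∈ range w
      · simp [hy]
      · simp [colourClass_adj_of_notMem hw hy, hy]
    rw [leafDeg, degIn, hset]
    split_ifs with hi <;> simp [hi, leafDeg, degIn]
  have : Fintype (((colourClass G w C L).comap w).neighborSet i) := by
    rwa [comap_colourClass hw]
  rw [degree_apply_eq hw, hleaf, degree_eq_ncard, comap_colourClass hw, ← degree_eq_ncard]

theorem isLocallyIrregular_colourClass (hw : Injective w) [DecidablePred (· ∈ L)] [C.LocallyFinite]
    [(colourClass G w C L).LocallyFinite]
    (hC : ∀ i j, C.Adj i j → (C.degree i + if i ∈ L then leafDeg G w i else 0) ≠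
      C.degree j + if j ∈ L then leafDeg G w j else 0)
    (hL : ∀ i ∈ L, ∀ y ∉ range w, G.Adj (w i) y →
      {j ∈ L | G.Adj (w j) y}.ncard ≠ C.degree i + leafDeg G w i) :
    IsLocallyIrregular (colourClass G w C L) := by
  have hleaf (i : ι) {y : V} (hy : y ∉ range w) (h : (colourClass G w C L).Adj (w i) y) :
      (colourClass G w C L).degree (w i) ≠ (colourClass G w C L).degree y := by
    obtain ⟨hi, hiy⟩ := (colourClass_adj_of_notMem hw hy).1 h
    rw [degree_colourClass_apply hw, degree_colourClass_of_notMem hw hy, if_pos hi]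
    exact (hL i hi y hy hiy).symm
  intro x y hxy
  by_cases hx : x ∈ range w <;> by_cases hy : y ∈ range w
  · obtain ⟨i, rfl⟩ := hx
    obtain ⟨j, rfl⟩ := hy
    rw [degree_colourClass_apply hw, degree_colourClass_apply hw]
    exact hC i j ((colourClass_adj_apply hw).1 hxy)
  · obtain ⟨i, rfl⟩ := hx
    exact hleaf i hy hxy
  · obtain ⟨j, rfl⟩ := hy
    exact (hleaf j hx hxy.symm).symm
  · exact (not_colourClass_adj hx hy hxy).elim

theorem IsSplitLabelling.irrColorable_two [Fintype V] [LinearOrder ι] [DecidablePred (· ∈ L)]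
    [C.LocallyFinite] [Cᶜ.LocallyFinite] (hw : IsSplitLabelling G w)
    (hred : ∀ i j, i < j → C.Adj i j → (C.degree i + if i ∈ L then leafDeg G w i else 0) ≠
      C.degree j + if j ∈ L then leafDeg G w j else 0)
    (hblue : ∀ i j, i < j → ¬ C.Adj i j →
      (Cᶜ.degree i + if i ∈ L then 0 else leafDeg G w i) ≠
        Cᶜ.degree j + if j ∈ L then 0 else leafDeg G w j)
    (hredLeaf : ∀ i ∈ L, ∀ y ∉ range w, G.Adj (w i) y →
      {j ∈ L | G.Adj (w j) y}.ncard ≠ C.degree i + leafDeg G w i)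
    (hblueLeaf : ∀ i ∉ L, ∀ y ∉ range w, G.Adj (w i) y →
      {j ∈ Lᶜ | G.Adj (w j) y}.ncard ≠ Cᶜ.degree i + leafDeg G w i) :
    IrrColorable G 2 := by
  classical
  refine irrColorable_two_iff.2 ⟨colourClass G w C L, colourClass_le hw,
    isLocallyIrregular_colourClass hw.injective (fun i j hij => ?_) hredLeaf, ?_⟩
  · rcases hij.ne.lt_or_gt with h | h
    · exact hred i j h hij
    · exact (hred j i h hij.symm).symm
  · convert isLocallyIrregular_colourClass (G := G) hw.injective (C := Cᶜ) (L := Lᶜ)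
      (fun i j hij => ?_) hblueLeaf
    · exact sdiff_colourClass hw
    · simp only [mem_compl_iff, ite_not]
      rcases hij.ne.lt_or_gt with h | h
      · exact hblue i j h ((C.compl_adj i j).1 hij).2
      · exact (hblue j i h ((C.compl_adj j i).1 hij.symm).2).symm

end ColourClasses

section ThresholdGraph

variable {n : ℕ}

/-- The graph on `Fin n` joining `i` and `j` if and only if `i + j ≥ 2 ⌊n / 2⌋`. It is almost
antiregular: the only coincidence among its degrees, and among those of its complement, is
between the vertices `⌊n / 2⌋ - 1` and `⌊n / 2⌋`. -/
def thresholdGraph (n : ℕ) : SimpleGraph (Fin n) where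
  Adj i j := i ≠ j ∧ 2 * (n / 2) ≤ i + j
  symm := ⟨fun _ _ h => ⟨h.1.symm, by omega⟩⟩

theorem thresholdGraph_adj {i j : Fin n} :
    (thresholdGraph n).Adj i j ↔ i ≠ j ∧ 2 * (n / 2) ≤ i + j := Iff.rfl

theorem degree_thresholdGraph (i : Fin n) [Fintype ((thresholdGraph n).neighborSet i)] :
    (thresholdGraph n).degree i = i + n % 2 - if n / 2 ≤ i then 1 else 0 := by
  have hset : (thresholdGraph n).neighborFinset i =
      (Finset.univ.filter fun j : Fin n => (j : ℕ) < 2 * (n / 2) - i)ᶜ.erase i := by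
    ext j
    rw [SimpleGraph.mem_neighborFinset]
    simp only [thresholdGraph_adj, Finset.mem_erase, Finset.mem_compl, Finset.mem_filter_univ]
    omega
  rw [← SimpleGraph.card_neighborFinset_eq_degree, hset, Finset.card_erase_eq_ite,
    Finset.card_compl, Fin.card_filter_val_lt, Fintype.card_fin]
  simp only [Finset.mem_compl, Finset.mem_filter_univ]
  split_ifs <;> omega

theorem degree_compl_thresholdGraph (i : Fin n) [Fintype ((thresholdGraph n)ᶜ.neighborSet i)] :
    (thresholdGraph n)ᶜ.degree i = 2 * (n / 2) - i - if i < n / 2 then 1 else 0 := by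
  classical
  rw [SimpleGraph.degree_compl, degree_thresholdGraph, Fintype.card_fin]
  split_ifs <;> omega

variable {V : Type*} {G : SimpleGraph V} {w : Fin n → V} {m : Fin n}

theorem ncard_adj_le_of_leafDeg_eq_zero [Finite V] {S : Set (Fin n)} (hm : 0 < (m : ℕ))
    (hzero : ∀ i ∈ S, (m : ℕ) ≤ i + 1 → i ≠ m → leafDeg G w i = 0) {y : V} (hy : y ∉ range w) :
    {j ∈ S | G.Adj (w j) y}.ncard ≤ m := by
  have hsub : {j ∈ S | G.Adj (w j) y} ⊆ (Finset.Iic m).erase ⟨m - 1, by omega⟩ := by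
    rintro j ⟨hj, hadj⟩
    have := leafDeg_pos_of_adj hy hadj
    have := hzero j hj
    simp only [Finset.coe_erase, Finset.coe_Iic, mem_sdiff, mem_Iic, mem_singleton_iff,
      Fin.ext_iff]
    omega
  refine (ncard_le_ncard hsub (Finset.finite_toSet _)).trans ?_
  rw [ncard_coe_finset, Finset.card_erase_of_mem (by simp [Fin.le_def]), Fin.card_Iic,
    Nat.add_sub_cancel]

variable [Fintype V]

theorem IsSplitLabelling.irrColorable_two_of_ne (hw : IsSplitLabelling G w) (hn : 2 ≤ n)
    (hm : (m : ℕ) = n / 2) (hanti : AntitoneOn (leafDeg G w) (Iio m))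
    (hzero : ∀ i : Fin n, (m : ℕ) ≤ i + 1 → i ≠ m → leafDeg G w i = 0)
    (hne : ∀ i < m, 2 * (m : ℕ) - 1 - i + leafDeg G w i ≠ m + leafDeg G w m) :
    IrrColorable G 2 := by
  classical
  refine hw.irrColorable_two (C := thresholdGraph n) (L := ∅) ?_ ?_ (by simp) ?_
  · intro i j hij h
    simp only [degree_thresholdGraph, mem_empty_iff_false, if_false]
    simp only [thresholdGraph_adj] at h
    split_ifs <;> omega
  · intro i j hij _
    have hi := hzero i
    have hj := hzero j
    simp only [degree_compl_thresholdGraph, mem_empty_iff_false, if_false]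
    rcases lt_trichotomy j m with hjm | rfl | hjm
    · have := hanti (hij.trans hjm) hjm hij.le
      split_ifs <;> omega
    · have := hne i hij
      split_ifs <;> omega
    · split_ifs <;> omega
  · intro i _ y hy hadj
    have := leafDeg_pos_of_adj hy hadj
    have := hzero i
    have := ncard_adj_le_of_leafDeg_eq_zero (by omega) (fun i _ => hzero i) hy
      (S := (∅ : Set (Fin n))ᶜ)
    rw [degree_compl_thresholdGraph]
    split_ifs <;> omega

theorem IsSplitLabelling.irrColorable_two_of_pos (hw : IsSplitLabelling G w)
    (hm : (m : ℕ) = n / 2) (hanti : AntitoneOn (leafDeg G w) (Iio m))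
    (hmono : MonotoneOn (leafDeg G w) (Ici m)) (hpos : ∀ i < m, 0 < leafDeg G w i)
    (hmax : leafDeg G w m = 1 → ∀ y ∉ range w, G.Adj (w m) y → ∃ j > m, ¬ G.Adj (w j) y) :
    IrrColorable G 2 := by
  classical
  refine hw.irrColorable_two (C := thresholdGraph n) (L := Ici m) ?_ ?_ ?_ ?_
  · intro i j hij h
    simp only [degree_thresholdGraph, mem_Ici]
    simp only [thresholdGraph_adj] at h
    rcases le_or_gt m i with hmi | him
    · have := hmono hmi (hmi.trans hij.le) hij.le
      split_ifs <;> omega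
    · split_ifs <;> omega
  · intro i j hij _
    simp only [degree_compl_thresholdGraph, mem_Ici]
    rcases lt_or_ge j m with hjm | hmj
    · have := hanti (hij.trans hjm) hjm hij.le
      split_ifs <;> omega
    · have := hpos i
      split_ifs <;> omega
  · intro i (hmi : m ≤ i) y hy hadj
    have := leafDeg_pos_of_adj hy hadj
    have hIci : (Ici m).ncard = n - m := by
      rw [← Finset.coe_Ici, ncard_coe_finset, Fin.card_Ici]
    have hcard : {j ∈ Ici m | G.Adj (w j) y}.ncard ≤ n - m :=
      hIci ▸ ncard_le_ncard (sep_subset _ _)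
    have hcard' (him : i = m) (hi : leafDeg G w i = 1) :
        {j ∈ Ici m | G.Adj (w j) y}.ncard < n - m := by
      subst him
      obtain ⟨j, hj, hjy⟩ := hmax hi y hy hadj
      exact hIci ▸ ncard_lt_ncard ⟨sep_subset _ _, fun h => hjy (h hj.le).2⟩
    rw [degree_thresholdGraph]
    split_ifs <;> omega
  · intro i hi y hy hadj
    rw [mem_Ici, not_le] at hi
    have hcard : {j ∈ (Ici m)ᶜ | G.Adj (w j) y}.ncard ≤ m := by
      refine (ncard_le_ncard (sep_subset _ _)).trans_eq ?_
      rw [compl_Ici, ← Finset.coe_Iio, ncard_coe_finset, Fin.card_Iio]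
    have := leafDeg_pos_of_adj hy hadj
    rw [degree_compl_thresholdGraph]
    split_ifs <;> omega

end ThresholdGraph

section Switching

open scoped symmDiff

variable {ι : Type*} {T F : SimpleGraph ι} {a b c l m x y i : ι}

theorem symmDiff_adj :
    (T ∆ F).Adj x y ↔ T.Adj x y ∧ ¬ F.Adj x y ∨ F.Adj x y ∧ ¬ T.Adj x y := Iff.rfl

theorem degree_symmDiff_of_neighborSet_eq_empty (hF : F.neighborSet i = ∅)
    [Fintype (T.neighborSet i)] [Fintype ((T ∆ F).neighborSet i)] :
    (T ∆ F).degree i = T.degree i := by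
  have hadj (j : ι) : ¬ F.Adj i j := fun h => (hF ▸ h : j ∈ (∅ : Set ι))
  have hset : (T ∆ F).neighborSet i = T.neighborSet i := by
    ext j
    simp [symmDiff_adj, hadj]
  rw [degree_eq_ncard, hset, degree_eq_ncard]

theorem degree_symmDiff_of_neighborSet_eq_pair (hF : F.neighborSet i = {x, y}) (hxy : x ≠ y)
    (hx : T.Adj i x) [Decidable (T.Adj i y)] [Fintype (T.neighborSet i)]
    [Fintype ((T ∆ F).neighborSet i)] :
    (T ∆ F).degree i + (if T.Adj i y then 2 else 0) = T.degree i := by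
  classical
  have hadj (j : ι) : F.Adj i j ↔ j = x ∨ j = y := Set.ext_iff.1 hF j
  have hset : (T ∆ F).neighborFinset i = if T.Adj i y then
      ((T.neighborFinset i).erase x).erase y else insert y ((T.neighborFinset i).erase x) := by
    ext j
    rw [SimpleGraph.mem_neighborFinset]
    split_ifs <;> simp [symmDiff_adj, hadj] <;> grind
  have hx' : x ∈ T.neighborFinset i := by simpa
  have hpos := Finset.card_pos.2 ⟨x, hx'⟩
  rw [← T.card_neighborFinset_eq_degree, ← (T ∆ F).card_neighborFinset_eq_degree, hset]
  split_ifs with hy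
  · have hy' : y ∈ (T.neighborFinset i).erase x := by simp [hxy.symm, hy]
    have := Finset.card_pos.2 ⟨y, hy'⟩
    grind
  · rw [Finset.card_insert_of_notMem (by simp [hy]), Finset.card_erase_of_mem hx']
    omega

theorem degree_symmDiff_of_alternating [DecidableEq ι] [Fintype (T.neighborSet i)]
    [Fintype ((T ∆ F).neighborSet i)]
    (h : F.neighborSet i = ∅ ∧ i ≠ l ∨
      ∃ x y, F.neighborSet i = {x, y} ∧ x ≠ y ∧ T.Adj i x ∧ (T.Adj i y ↔ i = l)) :
    (T ∆ F).degree i + (if i = l then 2 else 0) = T.degree i := by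
  classical
  obtain ⟨hF, hil⟩ | ⟨x, y, hF, hxy, hx, hy⟩ := h
  · rw [degree_symmDiff_of_neighborSet_eq_empty hF, if_neg hil, Nat.add_zero]
  · simpa only [hy] using degree_symmDiff_of_neighborSet_eq_pair hF hxy hx

/-- The cycle through five distinct vertices. If its edges alternate between edges and non-edges
of a graph, starting and ending with an edge at `l`, then switching them preserves all degrees
except that of `l`, which decreases by two. -/
def pentagon (l b m c a : ι) : SimpleGraph ι :=
  .fromEdgeSet {s(l, b), s(b, m), s(m, c), s(c, a), s(a, l)}

/-- The cycle through three distinct vertices, used for switching in the same way as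
`pentagon`. -/
def triangle (l b c : ι) : SimpleGraph ι :=
  .fromEdgeSet {s(l, b), s(b, c), s(c, l)}

theorem pentagon_adj : (pentagon l b m c a).Adj x y ↔ ((x = l ∧ y = b ∨ x = b ∧ y = l) ∨
    (x = b ∧ y = m ∨ x = m ∧ y = b) ∨ (x = m ∧ y = c ∨ x = c ∧ y = m) ∨
      (x = c ∧ y = a ∨ x = a ∧ y = c) ∨ x = a ∧ y = l ∨ x = l ∧ y = a) ∧ x ≠ y := by
  simp [pentagon]

theorem triangle_adj : (triangle l b c).Adj x y ↔ ((x = l ∧ y = b ∨ x = b ∧ y = l) ∨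
    (x = b ∧ y = c ∨ x = c ∧ y = b) ∨ x = c ∧ y = l ∨ x = l ∧ y = c) ∧ x ≠ y := by
  simp [triangle]

theorem degree_symmDiff_pentagon [DecidableEq ι] (hnodup : [l, b, m, c, a].Nodup)
    (hlb : T.Adj l b) (hbm : ¬ T.Adj b m) (hmc : T.Adj m c) (hca : ¬ T.Adj c a)
    (hal : T.Adj a l) (i : ι) [Fintype (T.neighborSet i)]
    [Fintype ((T ∆ pentagon l b m c a).neighborSet i)] :
    (T ∆ pentagon l b m c a).degree i + (if i = l then 2 else 0) = T.degree i := by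
  simp only [List.nodup_cons, List.mem_cons, List.not_mem_nil, not_or, or_false] at hnodup
  have hset {j k : ι} (h : ∀ x, (pentagon l b m c a).Adj i x ↔ x = j ∨ x = k) :
      (pentagon l b m c a).neighborSet i = {j, k} := Set.ext h
  refine degree_symmDiff_of_alternating ?_
  by_cases hi : i ∈ [l, b, m, c, a]
  · simp only [List.mem_cons, List.not_mem_nil, or_false] at hi
    right
    rcases hi with hi | hi | hi | hi | hi
    · exact ⟨b, a, hset (by grind [pentagon_adj]), by grind [T.adj_comm]⟩
    · exact ⟨l, m, hset (by grind [pentagon_adj]), by grind [T.adj_comm]⟩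
    · exact ⟨c, b, hset (by grind [pentagon_adj]), by grind [T.adj_comm]⟩
    · exact ⟨m, a, hset (by grind [pentagon_adj]), by grind [T.adj_comm]⟩
    · exact ⟨l, c, hset (by grind [pentagon_adj]), by grind [T.adj_comm]⟩
  · exact Or.inl ⟨eq_empty_of_forall_notMem fun j (h : (pentagon l b m c a).Adj i j) => by
      grind [pentagon_adj], by grind⟩

theorem degree_symmDiff_triangle [DecidableEq ι] (hnodup : [l, b, c].Nodup) (hlb : T.Adj l b)
    (hbc : ¬ T.Adj b c) (hcl : T.Adj c l) (i : ι) [Fintype (T.neighborSet i)]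
    [Fintype ((T ∆ triangle l b c).neighborSet i)] :
    (T ∆ triangle l b c).degree i + (if i = l then 2 else 0) = T.degree i := by
  simp only [List.nodup_cons, List.mem_cons, List.not_mem_nil, not_or, or_false] at hnodup
  have hset {j k : ι} (h : ∀ x, (triangle l b c).Adj i x ↔ x = j ∨ x = k) :
      (triangle l b c).neighborSet i = {j, k} := Set.ext h
  refine degree_symmDiff_of_alternating ?_
  by_cases hi : i ∈ [l, b, c]
  · simp only [List.mem_cons, List.not_mem_nil, or_false] at hi
    right
    rcases hi with hi | hi | hi
    · exact ⟨b, c, hset (by grind [triangle_adj]), by grind [T.adj_comm]⟩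
    · exact ⟨l, c, hset (by grind [triangle_adj]), by grind [T.adj_comm]⟩
    · exact ⟨l, b, hset (by grind [triangle_adj]), by grind [T.adj_comm]⟩
  · exact Or.inl ⟨eq_empty_of_forall_notMem fun j (h : (triangle l b c).Adj i j) => by
      grind [triangle_adj], by grind⟩

end Switching

section SwitchedThresholdGraph

open scoped symmDiff

variable {n : ℕ} {V : Type*} [Fintype V] {G : SimpleGraph V} {w : Fin n → V} {m l : Fin n}

theorem degree_compl_of_degree_add_eq (hl : (l : ℕ) + 1 = n) {Γ : SimpleGraph (Fin n)} {δ : ℕ}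
    (hδ : n / 2 + δ < n) {i : Fin n} [DecidableRel Γ.Adj] [DecidableRel (thresholdGraph n).Adj]
    (hdeg : Γ.degree i + (if i = l then δ else 0) = (thresholdGraph n).degree i) :
    Γᶜ.degree i = 2 * (n / 2) - i - (if i < n / 2 then 1 else 0) + if i = l then δ else 0 := by
  rw [degree_thresholdGraph] at hdeg
  rw [SimpleGraph.degree_compl, Fintype.card_fin]
  split_ifs at * <;> omega

theorem degree_ne_of_degree_add_eq (hm : (m : ℕ) = n / 2) (hl : (l : ℕ) + 1 = n)
    {Γ : SimpleGraph (Fin n)} [DecidableRel Γ.Adj] [DecidableRel (thresholdGraph n).Adj] {δ e : ℕ}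
    (hδ : m + δ < n) (he : 1 ≤ e)
    (hdeg : ∀ i, Γ.degree i + (if i = l then δ else 0) = (thresholdGraph n).degree i)
    (hmid : ∀ i : Fin n, (i : ℕ) + 1 = m → ¬ Γ.Adj i m)
    (hlast : ∀ i, Γ.Adj i l → (i : ℕ) + δ + 1 ≠ n + e) {i j : Fin n} (hij : i < j)
    (h : Γ.Adj i j) : Γ.degree i ≠ Γ.degree j + if j = l then e else 0 := by
  have hi := hdeg i
  have hj := hdeg j
  have := hmid i
  have hil : i ≠ l := by omega
  rw [degree_thresholdGraph] at hi hj
  simp only [hil, if_false] at hi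
  by_cases hjl : j = l
  · subst hjl
    have := hlast i h
    split_ifs at * <;> omega
  · simp only [hjl, if_false] at hj ⊢
    split_ifs at * <;> grind

theorem IsSplitLabelling.irrColorable_two_of_switch (hw : IsSplitLabelling G w)
    (hm : (m : ℕ) = n / 2) (hm2 : 2 ≤ (m : ℕ)) (hl : (l : ℕ) + 1 = n) {Γ : SimpleGraph (Fin n)}
    [DecidableRel Γ.Adj] [DecidableRel (thresholdGraph n).Adj] {δ : ℕ} (hδ : m + δ < n)
    (hdeg : ∀ i, Γ.degree i + (if i = l then δ else 0) = (thresholdGraph n).degree i)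
    (hmid : ∀ i : Fin n, (i : ℕ) + 1 = m → ¬ Γ.Adj i m)
    (hbot : ∀ i : Fin n, (i : ℕ) + leafDeg G w m + 1 = m → Γ.Adj i m)
    (hred : ∀ i, Γ.Adj i l → (i : ℕ) + δ + 1 ≠ n + leafDeg G w l)
    (hblue : ∀ i < l, ¬ Γ.Adj i l → (i : ℕ) + 1 < m ∨ m < i ∧ n ≤ i + δ)
    (hanti : AntitoneOn (leafDeg G w) (Iio m))
    (hzero : ∀ i : Fin n, (m : ℕ) ≤ i + 1 → i ≠ m → i ≠ l → leafDeg G w i = 0)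
    (hle : ∀ i < m, leafDeg G w i = 0 ∨ leafDeg G w m ≤ leafDeg G w i)
    (hpos : 1 ≤ leafDeg G w m) (hlast : 1 ≤ leafDeg G w l) :
    IrrColorable G 2 := by
  classical
  have hΓc (i : Fin n) := degree_compl_of_degree_add_eq hl (by omega) (hdeg i)
  refine hw.irrColorable_two (C := Γ) (L := {l}) ?_ ?_ ?_ ?_
  · intro i j hij h
    have hil : i ≠ l := by omega
    have hne := degree_ne_of_degree_add_eq hm hl hδ hlast hdeg hmid hred hij h
    simp only [mem_singleton_iff, hil, if_false]
    grind
  · intro i j hij h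
    have hil : i ≠ l := by omega
    simp only [mem_singleton_iff, hil, if_false]
    have hi := hzero i
    by_cases hjl : j = l
    · subst hjl
      have := hblue i hij h
      simp only [hΓc]
      split_ifs <;> omega
    have hj := hzero j
    simp only [hΓc, hil, hjl, if_false]
    rcases lt_trichotomy j m with hjm | rfl | hjm
    · have := hanti (hij.trans hjm) hjm hij.le
      split_ifs <;> omega
    · have := mt (hbot i) h
      have := hle i hij
      split_ifs <;> omega
    · split_ifs <;> omega
  · rintro i (rfl : i = l) y hy hadj
    have := leafDeg_pos_of_adj hy hadj
    have hcard := ncard_le_ncard (sep_subset ({i} : Set (Fin n)) fun j => G.Adj (w j) y)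
    rw [ncard_singleton] at hcard
    have hi := hdeg i
    rw [degree_thresholdGraph, if_pos rfl] at hi
    split_ifs at hi <;> omega
  · intro i hi y hy hadj
    have := leafDeg_pos_of_adj hy hadj
    have := hzero i
    have := ncard_adj_le_of_leafDeg_eq_zero (by omega) (fun i hi h h' => hzero i h h' hi) hy
      (S := {l}ᶜ)
    rw [hΓc]
    split_ifs <;> grind

theorem IsSplitLabelling.irrColorable_two_of_two_le_last (hw : IsSplitLabelling G w)
    (hn : 10 ≤ n) (hm : (m : ℕ) = n / 2) (hl : (l : ℕ) + 1 = n)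
    (hanti : AntitoneOn (leafDeg G w) (Iio m))
    (hzero : ∀ i : Fin n, (m : ℕ) ≤ i + 1 → i ≠ m → i ≠ l → leafDeg G w i = 0)
    (hle : ∀ i < m, leafDeg G w i = 0 ∨ leafDeg G w m ≤ leafDeg G w i)
    (hpos : 1 ≤ leafDeg G w m) (hlt : leafDeg G w m + 2 ≤ m) (hlast : 2 ≤ leafDeg G w l) :
    IrrColorable G 2 := by
  classical
  -- In the complement of `thresholdGraph n`, `b` is the only vertex below `m` which may conflict
  -- with `m`: the pentagon moves the edge between them to the other colour.
  obtain ⟨b, hb⟩ : ∃ b : Fin n, (b : ℕ) + leafDeg G w m + 1 = m :=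
    ⟨⟨m - 1 - leafDeg G w m, by omega⟩, by simp only; omega⟩
  obtain ⟨c, hc⟩ : ∃ c : Fin n, (c : ℕ) + 4 = n := ⟨⟨n - 4, by omega⟩, by simp only; omega⟩
  obtain ⟨a, ha, hab⟩ : ∃ a : Fin n, ((a : ℕ) = 1 ∨ (a : ℕ) = 2) ∧ a ≠ b := by
    by_cases hb1 : (b : ℕ) = 1
    · exact ⟨⟨2, by omega⟩, by simp, fun h => by simp [← h] at hb1⟩
    · exact ⟨⟨1, by omega⟩, by simp, fun h => by simp [← h] at hb1⟩
  have hdeg (i : Fin n) : (thresholdGraph n ∆ pentagon l b m c a).degree i +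
      (if i = l then 2 else 0) = (thresholdGraph n).degree i := by
    refine degree_symmDiff_pentagon ?_ ?_ ?_ ?_ ?_ ?_ i <;>
      grind [thresholdGraph_adj, List.nodup_cons, List.nodup_nil]
  refine hw.irrColorable_two_of_switch hm (by omega) hl (by omega) hdeg ?_ ?_ ?_ ?_ hanti hzero
    hle hpos (by omega) <;> intro i <;>
  · simp only [symmDiff_adj, thresholdGraph_adj, pentagon_adj]
    grind

theorem IsSplitLabelling.irrColorable_two_of_last_eq_one (hw : IsSplitLabelling G w)
    (hn : 10 ≤ n) (hm : (m : ℕ) = n / 2) (hl : (l : ℕ) + 1 = n)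
    (hanti : AntitoneOn (leafDeg G w) (Iio m))
    (hzero : ∀ i : Fin n, (m : ℕ) ≤ i + 1 → i ≠ m → i ≠ l → leafDeg G w i = 0)
    (hmid : leafDeg G w m = 1) (hlast : leafDeg G w l = 1) : IrrColorable G 2 := by
  classical
  obtain ⟨b, hb⟩ : ∃ b : Fin n, (b : ℕ) + 2 = m := ⟨⟨m - 2, by omega⟩, by simp only; omega⟩
  obtain ⟨c, hc⟩ : ∃ c : Fin n, (c : ℕ) + 4 = n := ⟨⟨n - 4, by omega⟩, by simp only; omega⟩
  obtain ⟨a, ha⟩ : ∃ a : Fin n, (a : ℕ) = 1 := ⟨⟨1, by omega⟩, rfl⟩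
  obtain ⟨e, he⟩ : ∃ e : Fin n, (e : ℕ) = 2 := ⟨⟨2, by omega⟩, rfl⟩
  have hpentagon (i : Fin n) : (thresholdGraph n ∆ pentagon l b m c a).degree i +
      (if i = l then 2 else 0) = (thresholdGraph n).degree i := by
    refine degree_symmDiff_pentagon ?_ ?_ ?_ ?_ ?_ ?_ i <;>
      grind [thresholdGraph_adj, List.nodup_cons, List.nodup_nil]
  -- After the first switch, the degree of `l` in its colour class agrees with that of the vertex
  -- `n - 2`; after the second, only with that of `c`, to which `l` is no longer joined.
  have htriangle (i : Fin n) :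
      ((thresholdGraph n ∆ pentagon l b m c a) ∆ triangle l e c).degree i +
        (if i = l then 2 else 0) = (thresholdGraph n ∆ pentagon l b m c a).degree i := by
    refine degree_symmDiff_triangle ?_ ?_ ?_ ?_ i <;>
      grind [symmDiff_adj, thresholdGraph_adj, pentagon_adj, List.nodup_cons, List.nodup_nil]
  have hdeg (i : Fin n) : ((thresholdGraph n ∆ pentagon l b m c a) ∆ triangle l e c).degree i +
      (if i = l then 4 else 0) = (thresholdGraph n).degree i := by
    rw [← hpentagon, ← htriangle]
    split_ifs <;> rfl
  refine hw.irrColorable_two_of_switch hm (by omega) hl (by omega) hdeg ?_ ?_ ?_ ?_ hanti hzero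
    (by omega) (by omega) (by omega) <;> intro i <;>
  · simp only [symmDiff_adj, thresholdGraph_adj, pentagon_adj, triangle_adj]
    grind (splits := 20)

theorem IsSplitLabelling.irrColorable_two_of_mid_le_last (hw : IsSplitLabelling G w)
    (hn : 10 ≤ n) (hm : (m : ℕ) = n / 2) (hl : (l : ℕ) + 1 = n)
    (hanti : AntitoneOn (leafDeg G w) (Iio m))
    (hzero : ∀ i : Fin n, (m : ℕ) ≤ i + 1 → i ≠ m → i ≠ l → leafDeg G w i = 0)
    (hle : ∀ i < m, leafDeg G w i = 0 ∨ leafDeg G w m ≤ leafDeg G w i)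
    (hpos : 1 ≤ leafDeg G w m) (hlt : leafDeg G w m + 2 ≤ m)
    (hlast : leafDeg G w m ≤ leafDeg G w l) : IrrColorable G 2 := by
  rcases le_or_gt 2 (leafDeg G w l) with hlast2 | hlast1
  · exact hw.irrColorable_two_of_two_le_last hn hm hl hanti hzero hle hpos hlt hlast2
  · exact hw.irrColorable_two_of_last_eq_one hn hm hl hanti hzero (by omega) (by omega)

end SwitchedThresholdGraph

section SortedLabelling

variable {n : ℕ} {V : Type*} [Fintype V] {G : SimpleGraph V} {w : Fin n → V} {m l t : Fin n}

theorem IsSplitLabelling.irrColorable_two_of_exists_not_adj {q : Fin n}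
    (hw : IsSplitLabelling G w) (hn : 3 ≤ n) (hm : (m : ℕ) = n / 2) (hl : (l : ℕ) + 1 = n)
    (hanti : Antitone (leafDeg G w)) (hpos : 0 < leafDeg G w m) (hqm : q ≤ m)
    (hq : leafDeg G w l = 1 → ∀ y ∉ range w, G.Adj (w l) y →
      ∃ j, (j = q ∨ m < j) ∧ ¬ G.Adj (w j) y) : IrrColorable G 2 := by
  -- `p` lists the labels up to `m` other than `q` in increasing order, then the other labels above
  -- `m` in decreasing order, then `q`.
  let p (i : Fin n) : Fin n := ⟨if i < q then i else if i < m then i + 1 else if i = l then q else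
    n - 1 + m - i, by split_ifs <;> omega⟩
  have hval (i : Fin n) : (p i : ℕ) = if i < q then (i : ℕ) else if i < m then i + 1 else
    if i = l then q else n - 1 + m - i := rfl
  have hp : Injective p := fun i j hij => by
    rw [Fin.ext_iff, hval, hval] at hij
    split_ifs at hij <;> omega
  refine (hw.comp hp).irrColorable_two_of_pos hm ?_ ?_ ?_ ?_
  · refine antitoneOn_leafDeg_comp hanti hp fun i (hi : i < m) j (hj : j < m) hij => ?_
    rw [Fin.le_def, hval, hval]
    split_ifs <;> omega
  · intro i (hi : m ≤ i) j (hj : m ≤ j) hij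
    simp only [leafDeg_comp hp]
    refine hanti (Fin.le_def.2 ?_)
    rw [hval, hval]
    split_ifs <;> omega
  · intro i hi
    rw [leafDeg_comp hp]
    refine hpos.trans_le (hanti (Fin.le_def.2 ?_))
    rw [hval]
    split_ifs <;> omega
  · intro hmid y hy hadj
    have hpm : p m = l := by
      rw [Fin.ext_iff, hval]
      split_ifs <;> omega
    rw [(Finite.surjective_of_injective hp).range_comp] at hy
    rw [leafDeg_comp hp, hpm] at hmid
    rw [comp_apply, hpm] at hadj
    obtain ⟨j, hj, hjy⟩ := hq hmid y hy hadj
    obtain ⟨i, rfl⟩ := Finite.surjective_of_injective hp j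
    refine ⟨i, ?_, hjy⟩
    have hil : p i ≠ l := fun h => hjy (h ▸ hadj)
    rw [Fin.lt_def, hval, Fin.ext_iff, hval] at hj
    rw [ne_eq, Fin.ext_iff, hval] at hil
    split_ifs at hj hil <;> omega

theorem IsSplitLabelling.irrColorable_two_of_mid_pos (hw : IsSplitLabelling G w) (hn : 3 ≤ n)
    (hm : (m : ℕ) = n / 2) (hl : (l : ℕ) + 1 = n) (hanti : Antitone (leafDeg G w))
    (hpos : 0 < leafDeg G w m)
    (hmax : leafDeg G w l = 1 → ∀ y ∉ range w, ∃ j, ¬ G.Adj (w j) y) : IrrColorable G 2 := by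
  by_cases hy : ∃ y ∉ range w, leafDeg G w l = 1 ∧ G.Adj (w l) y
  · obtain ⟨y, hy, hlast, hly⟩ := hy
    obtain ⟨j, hj⟩ := hmax hlast y hy
    refine hw.irrColorable_two_of_exists_not_adj hn hm hl hanti hpos (min_le_right j m)
      fun _ y' hy' hly' => ⟨j, by grind, ?_⟩
    rwa [eq_of_adj_of_leafDeg_eq_one hlast hy' hly' hy hly]
  · push Not at hy
    exact hw.irrColorable_two_of_exists_not_adj hn hm hl hanti hpos le_rfl
      fun hlast y hyw hly => (hy y hyw hlast hly).elim

theorem IsSplitLabelling.irrColorable_two_of_le_leafDeg (hw : IsSplitLabelling G w) (hn : 2 ≤ n)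
    (hm : (m : ℕ) = n / 2) (hanti : Antitone (leafDeg G w)) (ht : ∀ i, 0 < leafDeg G w i ↔ i ≤ t)
    (htm : t < m) (hle : m ≤ leafDeg G w t ∨ 1 ≤ (t : ℕ) ∧ m ≤ leafDeg G w t + 1) :
    IrrColorable G 2 := by
  -- `p` moves the label `t` to position `m`.
  let p (i : Fin n) : Fin n := ⟨if i < t then i else if i < m then i + 1 else if i = m then t else
    i, by split_ifs <;> omega⟩
  have hval (i : Fin n) : (p i : ℕ) = if i < t then (i : ℕ) else if i < m then i + 1 else
    if i = m then t else i := rfl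
  have hp : Injective p := fun i j hij => by
    rw [Fin.ext_iff, hval, hval] at hij
    split_ifs at hij <;> omega
  have hpm : p m = t := by
    rw [Fin.ext_iff, hval]
    split_ifs <;> omega
  refine (hw.comp hp).irrColorable_two_of_ne hn hm ?_ ?_ ?_
  · refine antitoneOn_leafDeg_comp hanti hp fun i (hi : i < m) j (hj : j < m) hij => ?_
    rw [Fin.le_def, hval, hval]
    split_ifs <;> omega
  · intro i hi him
    rw [leafDeg_comp hp]
    refine Nat.eq_zero_of_not_pos ?_
    rw [ht, Fin.le_def, hval]
    split_ifs <;> omega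
  · intro i hi
    simp only [leafDeg_comp hp, hpm]
    rcases lt_or_ge i t with hit | hti
    · have := hanti (Fin.le_def.2 (by rw [hval]; split_ifs <;> omega) : p i ≤ t)
      omega
    · have : leafDeg G w (p i) = 0 := by
        refine Nat.eq_zero_of_not_pos ?_
        rw [ht, Fin.le_def, hval]
        split_ifs <;> omega
      omega

theorem IsSplitLabelling.irrColorable_two_of_leafDeg_lt (hw : IsSplitLabelling G w) (hn : 10 ≤ n)
    (hm : (m : ℕ) = n / 2) (hanti : Antitone (leafDeg G w)) (ht : ∀ i, 0 < leafDeg G w i ↔ i ≤ t)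
    (htm : t < m) (ht1 : 1 ≤ (t : ℕ)) (hlt : leafDeg G w t + 2 ≤ m) : IrrColorable G 2 := by
  -- `p` moves the label `t` to position `m` and the label `0` to the last position.
  let p (i : Fin n) : Fin n := ⟨if (i : ℕ) + 1 = n then 0 else if (i : ℕ) + 1 < t then (i : ℕ) + 1
    else if i < m then (i : ℕ) + 2 else if i = m then (t : ℕ) else (i : ℕ) + 1,
    by split_ifs <;> omega⟩
  have hval (i : Fin n) : (p i : ℕ) = if (i : ℕ) + 1 = n then 0 else
    if (i : ℕ) + 1 < t then (i : ℕ) + 1 else if i < m then (i : ℕ) + 2 else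
    if i = m then (t : ℕ) else (i : ℕ) + 1 := rfl
  have hp : Injective p := fun i j hij => by
    rw [Fin.ext_iff, hval, hval] at hij
    split_ifs at hij <;> omega
  have hpm : p m = t := by
    rw [Fin.ext_iff, hval]
    split_ifs <;> omega
  obtain ⟨l, hl⟩ : ∃ l : Fin n, (l : ℕ) + 1 = n := ⟨⟨n - 1, by omega⟩, by simp only; omega⟩
  have hanti' : AntitoneOn (leafDeg G (w ∘ p)) (Iio m) := by
    refine antitoneOn_leafDeg_comp hanti hp fun i (hi : i < m) j (hj : j < m) hij => ?_
    rw [Fin.le_def, hval, hval]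
    split_ifs <;> omega
  have hzero (i : Fin n) (hi : (m : ℕ) ≤ i + 1) (him : i ≠ m) (hil : i ≠ l) :
      leafDeg G (w ∘ p) i = 0 := by
    rw [leafDeg_comp hp]
    refine Nat.eq_zero_of_not_pos ?_
    rw [ht, Fin.le_def, hval]
    split_ifs <;> omega
  have hle (i : Fin n) : leafDeg G (w ∘ p) i = 0 ∨ leafDeg G w t ≤ leafDeg G (w ∘ p) i := by
    rw [leafDeg_comp hp]
    exact (Nat.eq_zero_or_pos _).imp_right fun h => hanti ((ht _).1 h)
  have hmid : leafDeg G (w ∘ p) m = leafDeg G w t := by rw [leafDeg_comp hp, hpm]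
  have hpos : 0 < leafDeg G w t := (ht t).2 le_rfl
  have hlast : leafDeg G w t ≤ leafDeg G (w ∘ p) l := by
    rw [leafDeg_comp hp]
    refine hanti (Fin.le_def.2 ?_)
    rw [hval, if_pos hl]
    exact Nat.zero_le t
  exact (hw.comp hp).irrColorable_two_of_mid_le_last hn hm hl hanti' hzero
    (fun i _ => hmid ▸ hle i) (by omega) (by omega) (by omega)

theorem IsSplitLabelling.irrColorable_two_of_antitone {z o : Fin n} (hw : IsSplitLabelling G w)
    (hn : 10 ≤ n) (hanti : Antitone (leafDeg G w)) (hmax : ∀ y ∉ range w, ∃ j, ¬ G.Adj (w j) y)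
    (hz : (z : ℕ) = 0) (ho : (o : ℕ) = 1) (h : n / 2 ≤ leafDeg G w z ∨ 1 ≤ leafDeg G w o) :
    IrrColorable G 2 := by
  obtain ⟨m, hm⟩ : ∃ m : Fin n, (m : ℕ) = n / 2 := ⟨⟨n / 2, by omega⟩, rfl⟩
  obtain ⟨l, hl⟩ : ∃ l : Fin n, (l : ℕ) + 1 = n := ⟨⟨n - 1, by omega⟩, by simp only; omega⟩
  by_cases hmid : 0 < leafDeg G w m
  · exact hw.irrColorable_two_of_mid_pos (by omega) hm hl hanti hmid fun _ => hmax
  have hzpos : 0 < leafDeg G w z := by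
    have := hanti (Fin.le_def.2 (by omega) : z ≤ o)
    omega
  obtain ⟨t, ht⟩ : ∃ t, ∀ i, 0 < leafDeg G w i ↔ i ≤ t := by
    obtain ⟨t, ht⟩ := exists_maximal_of_wellFoundedGT (fun i => 0 < leafDeg G w i) ⟨z, hzpos⟩
    exact ⟨t, fun i => ⟨fun hi => le_of_not_gt fun hti => ht.not_prop_of_gt hti hi,
      fun hi => ht.prop.trans_le (hanti hi)⟩⟩
  have htm : t < m := by
    rw [← not_le, ← ht]
    omega
  by_cases hle : m ≤ leafDeg G w t ∨ 1 ≤ (t : ℕ) ∧ m ≤ leafDeg G w t + 1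
  · exact hw.irrColorable_two_of_le_leafDeg (by omega) hm hanti ht htm hle
  · have htz : t ≠ z := by
      rintro rfl
      have := mt (ht o).1 (by omega)
      omega
    exact hw.irrColorable_two_of_leafDeg_lt hn hm hanti ht htm (by omega) (by omega)

end SortedLabelling

section DegreeSequences

variable {ι : Type*} [Fintype ι] (C : SimpleGraph ι) [DecidableRel C.Adj] {z : ι}

theorem sum_degree_le_card_mul_add_sum [DecidableEq ι] (T : Finset ι) :
    ∑ i ∈ T, C.degree i ≤ T.card * (T.card - 1) + ∑ j ∈ Tᶜ, (C.neighborFinset j ∩ T).card := by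
  have hsplit (i : ι) : C.degree i =
      (C.neighborFinset i ∩ T).card + (Tᶜ.bipartiteAbove C.Adj i).card := by
    rw [← C.card_neighborFinset_eq_degree, ← Finset.card_inter_add_card_sdiff _ T]
    congr 2
    ext j
    simp [Finset.mem_bipartiteAbove, and_comm]
  have hinside : ∀ i ∈ T, (C.neighborFinset i ∩ T).card ≤ T.card - 1 := by
    intro i hi
    rw [← Finset.card_erase_of_mem hi]
    refine Finset.card_le_card fun j hj => ?_
    rw [Finset.mem_inter, C.mem_neighborFinset] at hj
    exact Finset.mem_erase.2 ⟨hj.1.ne', hj.2⟩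
  simp only [hsplit, Finset.sum_add_distrib]
  refine add_le_add ((Finset.sum_le_sum hinside).trans_eq (Finset.sum_const_nat fun _ _ => rfl)) ?_
  rw [Finset.sum_card_bipartiteAbove_eq_sum_card_bipartiteBelow]
  refine Finset.sum_le_sum fun j _ => Finset.card_le_card fun i hi => ?_
  simpa [C.adj_comm, and_comm, Finset.mem_bipartiteBelow] using hi

-- The hypothesis forces equality throughout `sum_degree_le_card_mul_add_sum`.
theorem neighborFinset_eq_of_sum_degree_add_sq_le [DecidableEq ι] {T : Finset ι} (hz : z ∉ T)
    (h : ∑ j ∈ Tᶜ.erase z, C.degree j + T.card ^ 2 ≤ ∑ i ∈ T, C.degree i) :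
    C.neighborFinset z = T := by
  have hdeg (j : ι) : (C.neighborFinset j ∩ T).card + (if C.Adj z j then 1 else 0) ≤
      C.degree j := by
    rw [← C.card_neighborFinset_eq_degree]
    split_ifs with hj
    · exact Finset.card_lt_card ⟨Finset.inter_subset_left, fun hsub =>
        hz (Finset.mem_inter.1 (hsub ((C.mem_neighborFinset j z).2 hj.symm))).2⟩
    · exact Finset.card_le_card Finset.inter_subset_left
  have hsum := Finset.sum_le_sum fun j (_ : j ∈ Tᶜ.erase z) => hdeg j
  rw [Finset.sum_add_distrib, Finset.sum_boole, Nat.cast_id] at hsum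
  have hle := sum_degree_le_card_mul_add_sum C T
  rw [← Finset.add_sum_erase _ _ (Finset.mem_compl.2 hz)] at hle
  have hsq : T.card ^ 2 = T.card * (T.card - 1) + T.card := by
    rw [pow_two, Nat.mul_sub_one, Nat.sub_add_cancel (Nat.le_mul_self _)]
  have hcard : (C.neighborFinset z ∩ T).card ≤ T.card :=
    Finset.card_le_card Finset.inter_subset_right
  have hT : C.neighborFinset z ∩ T = T :=
    Finset.eq_of_subset_of_card_le Finset.inter_subset_right (by omega)
  have hempty : {j ∈ Tᶜ.erase z | C.Adj z j} = ∅ := Finset.card_eq_zero.1 (by omega)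
  refine Finset.Subset.antisymm (fun j hj => ?_) (Finset.inter_eq_right.1 hT)
  rw [C.mem_neighborFinset] at hj
  by_contra hjT
  exact Finset.filter_eq_empty_iff.1 hempty
    (Finset.mem_erase.2 ⟨hj.ne', Finset.mem_compl.2 hjT⟩) hj

theorem Ico_filter_le_two_mul (n : ℕ) :
    {k ∈ Finset.Ico 1 n | n ≤ 2 * k} = Finset.Ico (n - n / 2) n := by
  ext k
  rw [Finset.mem_filter, Finset.mem_Ico, Finset.mem_Ico]
  omega

theorem sum_Ico_filter_le_two_mul (n : ℕ) :
    ∑ k ∈ Finset.Ico 1 n with n ≤ 2 * k, k =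
      ∑ k ∈ Finset.Ico 1 n with ¬ n ≤ 2 * k, k + (n / 2) ^ 2 := by
  have hsmall : ∑ k ∈ Finset.Ico 1 n with ¬ n ≤ 2 * k, k = ∑ k ∈ Finset.range (n - n / 2), k := by
    refine Finset.sum_subset (fun k hk => ?_) fun k hk hk' => ?_ <;>
      simp only [Finset.mem_filter, Finset.mem_Ico, Finset.mem_range] at * <;> omega
  rw [hsmall, Ico_filter_le_two_mul, Finset.sum_Ico_eq_sum_range,
    Nat.sub_sub_self (Nat.div_le_self n 2), Finset.sum_add_distrib, Finset.sum_const,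
    Finset.card_range, smul_eq_mul]
  obtain ⟨m, rfl | rfl⟩ := Nat.even_or_odd' n
  · rw [show 2 * m / 2 = m by omega, show 2 * m - m = m by omega]
    ring
  · rw [show (2 * m + 1) / 2 = m by omega, show 2 * m + 1 - m = m + 1 by omega,
      Finset.sum_range_succ]
    ring

theorem image_degree_erase [DecidableEq ι] (hinj : InjOn (fun i => C.degree i) {z}ᶜ)
    (hpos : ∀ i ≠ z, 0 < C.degree i) :
    (Finset.univ.erase z).image (fun i => C.degree i) = Finset.Ico 1 (Fintype.card ι) := by
  refine Finset.eq_of_subset_of_card_le ?_ ?_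
  · refine Finset.image_subset_iff.2 fun i hi => Finset.mem_Ico.2 ?_
    exact ⟨hpos i (Finset.ne_of_mem_erase hi), C.degree_lt_card_verts i⟩
  · rw [Finset.card_image_of_injOn (hinj.mono fun i hi => by simpa using hi),
      Finset.card_erase_of_mem (Finset.mem_univ z), Nat.card_Ico, Finset.card_univ]

theorem exists_degree_eq_of_injOn (hinj : InjOn (fun i => C.degree i) {z}ᶜ)
    (hpos : ∀ i ≠ z, 0 < C.degree i) {k : ℕ} (hk : 0 < k) (hkn : k < Fintype.card ι) :
    ∃ i ≠ z, C.degree i = k := by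
  classical
  have := (image_degree_erase C hinj hpos).ge (Finset.mem_Ico.2 ⟨hk, hkn⟩)
  simpa using this

theorem sum_filter_degree [DecidableEq ι] (hinj : InjOn (fun i => C.degree i) {z}ᶜ)
    (hpos : ∀ i ≠ z, 0 < C.degree i) (p : ℕ → Prop) [DecidablePred p] (f : ℕ → ℕ) :
    ∑ i ∈ Finset.univ.erase z with p (C.degree i), f (C.degree i) =
      ∑ k ∈ Finset.Ico 1 (Fintype.card ι) with p k, f k := by
  rw [← image_degree_erase C hinj hpos, Finset.filter_image,
    Finset.sum_image (hinj.mono fun i hi => Finset.ne_of_mem_erase (Finset.mem_of_mem_filter i hi))]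

theorem card_filter_le_two_mul_degree [DecidableEq ι] (hinj : InjOn (fun i => C.degree i) {z}ᶜ)
    (hpos : ∀ i ≠ z, 0 < C.degree i) :
    {i ∈ Finset.univ.erase z | Fintype.card ι ≤ 2 * C.degree i}.card = Fintype.card ι / 2 := by
  have hcard := sum_filter_degree C hinj hpos (fun k => Fintype.card ι ≤ 2 * k) 1
  simp only [Pi.one_apply, Finset.sum_const, smul_eq_mul, mul_one] at hcard
  rw [hcard, Ico_filter_le_two_mul, Nat.card_Ico, Nat.sub_sub_self (Nat.div_le_self _ 2)]

theorem neighborFinset_eq_of_injOn_degree [DecidableEq ι] (hinj : InjOn (fun i => C.degree i) {z}ᶜ)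
    (hpos : ∀ i ≠ z, 0 < C.degree i) :
    C.neighborFinset z =
      {i ∈ Finset.univ.erase z | Fintype.card ι ≤ 2 * C.degree i} := by
  have hT := sum_filter_degree C hinj hpos (fun k => Fintype.card ι ≤ 2 * k) fun k => k
  have hB := sum_filter_degree C hinj hpos (fun k => ¬ Fintype.card ι ≤ 2 * k) fun k => k
  have hcompl : {i ∈ Finset.univ.erase z | Fintype.card ι ≤ 2 * C.degree i}ᶜ.erase z =
      {i ∈ Finset.univ.erase z | ¬ Fintype.card ι ≤ 2 * C.degree i} := by
    ext i
    simp only [Finset.mem_compl, Finset.mem_filter, Finset.mem_erase, Finset.mem_univ, and_true]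
    tauto
  refine neighborFinset_eq_of_sum_degree_add_sq_le C (by simp) (le_of_eq ?_)
  rw [hcompl, card_filter_le_two_mul_degree C hinj hpos, hT, hB, sum_Ico_filter_le_two_mul]

theorem degree_eq_half_of_injOn (hinj : InjOn (fun i => C.degree i) {z}ᶜ)
    (hpos : ∀ i ≠ z, 0 < C.degree i) : C.degree z = Fintype.card ι / 2 := by
  classical
  rw [← C.card_neighborFinset_eq_degree, neighborFinset_eq_of_injOn_degree C hinj hpos,
    card_filter_le_two_mul_degree C hinj hpos]

end DegreeSequences

section PendantLeaves

variable {V ι : Type*} {G R : SimpleGraph V} {w : ι → V} {z : ι}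

theorem IsSplitLabelling.comap_sdiff (hw : IsSplitLabelling G w) (R : SimpleGraph V) :
    (G \ R).comap w = (R.comap w)ᶜ := by
  ext i j
  rw [SimpleGraph.comap_adj, SimpleGraph.sdiff_adj, SimpleGraph.compl_adj, SimpleGraph.comap_adj]
  exact and_congr_left' ⟨fun h hij => h.ne (congrArg w hij), fun h => hw.adj h⟩

variable [Finite V]

theorem leafDeg_add_leafDeg_sdiff (hR : R ≤ G) (w : ι → V) (i : ι) :
    leafDeg R w i + leafDeg (G \ R) w i = leafDeg G w i := by
  have hsub : R.neighborSet (w i) ⊆ G.neighborSet (w i) := fun _ h => hR h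
  rw [leafDeg, leafDeg, leafDeg, degIn, degIn, degIn, SimpleGraph.neighborSet_sdiff,
    ← ncard_union_eq, ← union_inter_distrib_right, union_sdiff_cancel hsub]
  exact disjoint_sdiff_self_right.mono inter_subset_left inter_subset_left

theorem IsSplitLabelling.degree_sdiff_apply [Fintype ι] (hw : IsSplitLabelling G w)
    (R : SimpleGraph V) (i : ι) [Fintype ((G \ R).neighborSet (w i))]
    [Fintype ((R.comap w).neighborSet i)] :
    (G \ R).degree (w i) =
      Fintype.card ι - 1 - (R.comap w).degree i + leafDeg (G \ R) w i := by
  classical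
  rw [degree_apply_eq hw.injective, degree_eq_ncard, hw.comap_sdiff, ← degree_eq_ncard,
    ← (R.comap w).degree_compl]

theorem IsSplitLabelling.injOn_degree_comap [Finite ι] (hw : IsSplitLabelling G w)
    (hzero : ∀ i ≠ z, leafDeg G w i = 0) (hRG : R ≤ G) [(R.comap w).LocallyFinite]
    [R.LocallyFinite] [(G \ R).LocallyFinite] (hR : IsLocallyIrregular R)
    (hS : IsLocallyIrregular (G \ R)) : InjOn (fun i => (R.comap w).degree i) {z}ᶜ := by
  have := Fintype.ofFinite ι
  intro i hi j hj hij
  by_contra hne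
  have hleafi := leafDeg_add_leafDeg_sdiff hRG w i
  have hleafj := leafDeg_add_leafDeg_sdiff hRG w j
  have := hzero i hi
  have := hzero j hj
  simp only at hij
  by_cases h : R.Adj (w i) (w j)
  · have := hR h
    rw [degree_apply_eq hw.injective, degree_apply_eq hw.injective] at this
    omega
  · have := hS ⟨hw.adj hne, h⟩
    rw [hw.degree_sdiff_apply, hw.degree_sdiff_apply] at this
    omega

variable [Fintype ι]

theorem IsSplitLabelling.half_le_leafDeg_of_pos (hw : IsSplitLabelling G w)
    (hzero : ∀ i ≠ z, leafDeg G w i = 0) (hRG : R ≤ G) [DecidableRel (R.comap w).Adj]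
    [R.LocallyFinite] [(G \ R).LocallyFinite] (hR : IsLocallyIrregular R)
    (hS : IsLocallyIrregular (G \ R)) (hpos : ∀ i ≠ z, 0 < (R.comap w).degree i) :
    Fintype.card ι / 2 ≤ leafDeg G w z := by
  classical
  have hinj := hw.injOn_degree_comap hzero hRG hR hS
  have hhalf := degree_eq_half_of_injOn _ hinj hpos
  have hnbr (i : ι) (hi : i ≠ z) :
      R.Adj (w z) (w i) ↔ Fintype.card ι ≤ 2 * (R.comap w).degree i := by
    have := Finset.ext_iff.1 (neighborFinset_eq_of_injOn_degree _ hinj hpos) i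
    simpa [hi] using this
  have hleaf := leafDeg_add_leafDeg_sdiff hRG w
  have hred (k : ℕ) (hk : 0 < k) (hkn : k < Fintype.card ι) (hnk : Fintype.card ι ≤ 2 * k) :
      Fintype.card ι / 2 + leafDeg R w z ≠ k := by
    obtain ⟨i, hi, rfl⟩ := exists_degree_eq_of_injOn _ hinj hpos hk hkn
    have := hR ((hnbr i hi).2 hnk)
    rw [degree_apply_eq hw.injective, degree_apply_eq hw.injective, hhalf] at this
    have := hleaf i
    have := hzero i hi
    omega
  have hblue (k : ℕ) (hk : 0 < k) (hkn : k < Fintype.card ι) (hnk : ¬ Fintype.card ι ≤ 2 * k) :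
      Fintype.card ι / 2 ≠ k + leafDeg (G \ R) w z := by
    obtain ⟨i, hi, rfl⟩ := exists_degree_eq_of_injOn _ hinj hpos hk hkn
    have := hS ⟨hw.adj hi.symm, mt (hnbr i hi).1 hnk⟩
    rw [hw.degree_sdiff_apply, hw.degree_sdiff_apply, hhalf] at this
    have := hleaf i
    have := hzero i hi
    omega
  have := hred (Fintype.card ι / 2 + leafDeg R w z)
  have := hblue (Fintype.card ι / 2 - leafDeg (G \ R) w z)
  have := hleaf z
  omega

theorem IsSplitLabelling.half_le_leafDeg [Fintype V] (hw : IsSplitLabelling G w)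
    (hzero : ∀ i ≠ z, leafDeg G w i = 0) (hG : IrrColorable G 2) :
    Fintype.card ι / 2 ≤ leafDeg G w z := by
  classical
  obtain ⟨R, hRG, hR, hS⟩ := irrColorable_two_iff.1 hG
  by_cases hpos : ∀ i ≠ z, 0 < (R.comap w).degree i
  · exact hw.half_le_leafDeg_of_pos hzero hRG hR hS hpos
  · push Not at hpos
    obtain ⟨i, hiz, hi⟩ := hpos
    have hnot (j : ι) : ¬ (R.comap w).Adj i j := fun h =>
      hi.not_gt ((R.comap w).degree_pos_iff_exists_adj i |>.2 ⟨j, h⟩)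
    have hadj (j : ι) (hij : i ≠ j) : ((G \ R).comap w).Adj i j := ⟨hw.adj hij, hnot j⟩
    refine hw.half_le_leafDeg_of_pos (R := G \ R) hzero sdiff_le hS ?_ fun j _ => ?_
    · convert hR
      exact sdiff_sdiff_eq_self hRG
    · rw [SimpleGraph.degree_pos_iff_exists_adj]
      by_cases hij : i = j
      · exact ⟨z, hij ▸ hadj z hiz⟩
      · exact ⟨i, (hadj j hij).symm⟩

end PendantLeaves

section ThreeColours

variable {V : Type*} {G : SimpleGraph V} {n : ℕ} {w : Fin (n + 1) → V} {x : V} {A : Set V}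
  {S : Set (Fin (n + 1))}

theorem isLocallyIrregular_between_singleton [(G.between {x} A).LocallyFinite]
    (hx : (G.between {x} A).degree x ≠ 1) : IsLocallyIrregular (G.between {x} A) := by
  have hstar {u v : V} (h : (G.between {x} A).Adj u v) : u = x ∨ v = x :=
    h.2.imp And.left And.right
  have hleaf {v : V} (h : (G.between {x} A).Adj x v) : (G.between {x} A).degree v = 1 :=
    SimpleGraph.degree_eq_one_iff_existsUnique_adj.2
      ⟨x, h.symm, fun u hu => (hstar hu).resolve_left h.ne'⟩
  intro u v h
  obtain rfl | rfl := hstar h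
  · exact hleaf h ▸ hx
  · exact (hleaf h.symm ▸ hx).symm

theorem sdiff_between_adj_zero_iff (hw : IsSplitLabelling G w) {i : Fin (n + 1)} (hi : i ≠ 0) :
    (G \ G.between {w 0} (w '' S)ᶜ).Adj (w i) (w 0) ↔ i ∈ S := by
  have hne : w i ≠ w 0 := hw.injective.ne hi
  simp [SimpleGraph.sdiff_adj, SimpleGraph.between_adj, hw.adj hi, hne,
    hw.injective.mem_set_image, -mem_image]

theorem compl_range_comp_succ (hw : Injective w) :
    (range (w ∘ Fin.succ))ᶜ = insert (w 0) (range w)ᶜ := by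
  have hrange : range w = insert (w 0) (range (w ∘ Fin.succ)) := Fin.range_fin_succ w
  have hzero : w 0 ∉ range (w ∘ Fin.succ) := fun ⟨i, hi⟩ => i.succ_ne_zero (hw hi)
  rw [hrange]
  grind

theorem IsSplitLabelling.sdiff_between (hw : IsSplitLabelling G w) (S : Set (Fin (n + 1))) :
    IsSplitLabelling (G \ G.between {w 0} (w '' S)ᶜ) (w ∘ Fin.succ) where
  injective := hw.injective.comp (Fin.succ_injective n)
  adj i j hij := by
    have := hw.injective.ne i.succ_ne_zero
    have := hw.injective.ne j.succ_ne_zero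
    refine ⟨hw.adj ((Fin.succ_injective n).ne hij), fun h => ?_⟩
    simp_all [SimpleGraph.between_adj]
  isIndepSet := by
    rw [compl_range_comp_succ hw.injective]
    have : Std.Symm fun x y => ¬ (G \ G.between {w 0} (w '' S)ᶜ).Adj x y :=
      ⟨fun _ _ h h' => h h'.symm⟩
    refine pairwise_insert_of_symm.2
      ⟨hw.isIndepSet.mono' fun _ _ h h' => h h'.1, fun y hy _ h => h.2 ⟨h.1, ?_⟩⟩
    exact Or.inl ⟨rfl, fun hyS => hy (image_subset_range w S hyS)⟩

theorem leafDeg_sdiff_between [Finite V] (hw : IsSplitLabelling G w) {i : Fin n}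
    [Decidable (i.succ ∈ S)] (hi : leafDeg G w i.succ = 0) :
    leafDeg (G \ G.between {w 0} (w '' S)ᶜ) (w ∘ Fin.succ) i = if i.succ ∈ S then 1 else 0 := by
  have hzero := sdiff_between_adj_zero_iff (S := S) hw i.succ_ne_zero
  have hset : (G \ G.between {w 0} (w '' S)ᶜ).neighborSet (w i.succ) ∩ insert (w 0) (range w)ᶜ =
      {y ∈ ({w 0} : Set V) | i.succ ∈ S} := by
    ext y
    refine ⟨fun ⟨hadj, hy⟩ => ?_, ?_⟩
    · obtain rfl | hy := hy
      · exact ⟨rfl, hzero.1 hadj⟩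
      · exact absurd hi (leafDeg_pos_of_adj hy hadj.1).ne'
    · rintro ⟨rfl, hS⟩
      exact ⟨hzero.2 hS, mem_insert _ _⟩
  rw [leafDeg, degIn, compl_range_comp_succ hw.injective, comp_apply, hset]
  split_ifs with hS <;> simp [hS]

theorem IsSplitLabelling.irrColorable_three [Fintype V] (hw : IsSplitLabelling G w) (hn : 5 ≤ n)
    (hzero : ∀ i ≠ 0, leafDeg G w i = 0) : IrrColorable G 3 := by
  classical
  let S : Set (Fin (n + 1)) := {i | (i : ℕ) + 1 < n}
  have hS (i : Fin (n + 1)) : i ∈ S ↔ (i : ℕ) + 1 < n := Iff.rfl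
  refine irrColorable_succ_iff.2 ⟨G.between {w 0} (w '' S)ᶜ, fun _ _ h => h.1, ?_, ?_⟩
  · have hadj (i : Fin (n + 1)) (hi : n ≤ (i : ℕ) + 1) :
        (G.between {w 0} (w '' S)ᶜ).Adj (w 0) (w i) := by
      have h0 : (0 : Fin (n + 1)) ≠ i := by
        rw [ne_eq, Fin.ext_iff, Fin.val_zero]
        omega
      refine ⟨hw.adj h0, Or.inl ⟨rfl, ?_⟩⟩
      rw [mem_compl_iff, hw.injective.mem_set_image, hS]
      omega
    have hdeg : (G.between {w 0} (w '' S)ᶜ).degree (w 0) ≠ 1 := fun h => by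
      have huniq := (SimpleGraph.degree_eq_one_iff_existsUnique_adj.1 h).unique
        (hadj (Fin.last n) (by simp)) (hadj ⟨n - 1, by omega⟩ le_tsub_add)
      have := Fin.ext_iff.1 (hw.injective huniq)
      simp only [Fin.val_last] at this
      omega
    convert isLocallyIrregular_between_singleton hdeg
  · have hleaf (i : Fin n) := leafDeg_sdiff_between (S := S) hw (hzero _ i.succ_ne_zero)
    simp only [hS, Fin.val_succ] at hleaf
    refine (hw.sdiff_between S).irrColorable_two_of_mid_pos (m := ⟨n / 2, by omega⟩)
      (l := ⟨n - 1, by omega⟩) (by omega) rfl (Nat.sub_add_cancel (by omega)) ?_ ?_ ?_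
    · intro i j hij
      rw [hleaf, hleaf]
      split_ifs <;> omega
    · rw [hleaf, if_pos (by simp only; omega)]
      exact Nat.one_pos
    · rw [hleaf, if_neg (by simp only; omega)]
      exact fun h => absurd h Nat.zero_ne_one

end ThreeColours

section ChromaticIndex

variable {n : ℕ} {V : Type*} {G : SimpleGraph V} {w : Fin n → V} {z o : Fin n}

theorem leafDeg_eq_zero_of_antitone (hanti : Antitone (leafDeg G w)) (hz : (z : ℕ) = 0)
    (ho : (o : ℕ) = 1) (h : leafDeg G w o = 0) (i : Fin n) (hi : i ≠ z) : leafDeg G w i = 0 :=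
  Nat.eq_zero_of_le_zero (h ▸ hanti (Fin.le_def.2 (by omega)))

variable [Fintype V]

theorem IsSplitLabelling.irrColorable_two_iff_of_antitone (hw : IsSplitLabelling G w) (hn : 10 ≤ n)
    (hanti : Antitone (leafDeg G w)) (hmax : ∀ y ∉ range w, ∃ j, ¬ G.Adj (w j) y)
    (hz : (z : ℕ) = 0) (ho : (o : ℕ) = 1) :
    IrrColorable G 2 ↔ n / 2 ≤ leafDeg G w z ∨ 1 ≤ leafDeg G w o := by
  refine ⟨fun h => ?_, hw.irrColorable_two_of_antitone hn hanti hmax hz ho⟩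
  refine or_iff_not_imp_right.2 fun hpos => ?_
  rw [Nat.one_le_iff_ne_zero, not_not] at hpos
  simpa using hw.half_le_leafDeg (leafDeg_eq_zero_of_antitone hanti hz ho hpos) h

theorem IsSplitLabelling.irrColorable_three_of_antitone (hw : IsSplitLabelling G w) (hn : 10 ≤ n)
    (hanti : Antitone (leafDeg G w)) (hmax : ∀ y ∉ range w, ∃ j, ¬ G.Adj (w j) y)
    (hz : (z : ℕ) = 0) (ho : (o : ℕ) = 1) : IrrColorable G 3 := by
  rcases Nat.eq_zero_or_pos (leafDeg G w o) with h | h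
  · obtain ⟨n, rfl⟩ := Nat.exists_eq_add_of_le' (Nat.one_le_of_lt hn)
    obtain rfl : z = 0 := Fin.ext hz
    exact hw.irrColorable_three (by omega) (leafDeg_eq_zero_of_antitone hanti hz ho h)
  · exact (hw.irrColorable_two_of_antitone hn hanti hmax hz ho (Or.inr h)).mono (Nat.le_succ 2)

end ChromaticIndex

end SplitIrr

theorem theorem1 {V : Type*} [Fintype V] (G : SimpleGraph V) (X Y : Set V)
    (hG : SplitIrr.IsSplit G X Y) (n : ℕ) (hn : 10 ≤ n)
    (v : Fin n → V) (hv : Function.Injective v) (hX : Set.range v = X)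
    (d : Fin n → ℕ) (hd : ∀ i, d i = SplitIrr.degIn G (v i) Y) (hanti : Antitone d) :
    (SplitIrr.irrChromaticIndex G ≤ 2 ↔ n / 2 ≤ d ⟨0, by omega⟩ ∨ 1 ≤ d ⟨1, by omega⟩) ∧
    (SplitIrr.irrChromaticIndex G = 3 ↔ d ⟨0, by omega⟩ < n / 2 ∧ d ⟨1, by omega⟩ = 0) ∧
    SplitIrr.irrChromaticIndex G ≤ 3 := by
  have hw := hG.isSplitLabelling hv hX
  obtain rfl : SplitIrr.leafDeg G v = d :=
    funext fun i => by rw [hd, hG.compl, ← hX, SplitIrr.leafDeg]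
  have hmax (y : V) (hy : y ∉ Set.range v) : ∃ j, ¬ G.Adj (v j) y := by
    obtain ⟨_, hx, hxy⟩ := hG.exists_not_adj (hX ▸ hy)
    obtain ⟨j, rfl⟩ := hX.ge hx
    exact ⟨j, hxy⟩
  have htwo := hw.irrColorable_two_iff_of_antitone hn hanti hmax (z := ⟨0, by omega⟩)
    (o := ⟨1, by omega⟩) rfl rfl
  have hthree := hw.irrColorable_three_of_antitone hn hanti hmax (z := ⟨0, by omega⟩)
    (o := ⟨1, by omega⟩) rfl rfl
  refine ⟨SplitIrr.irrChromaticIndex_le_iff.trans htwo, ?_,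
    SplitIrr.irrChromaticIndex_le_iff.2 hthree⟩
  refine (SplitIrr.irrChromaticIndex_eq_succ_iff (k := 2)).trans ?_
  rw [htwo]
  simp only [hthree, true_and]
  omega
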